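/- Let $\mathcal H$ be a separable complex Hilbert space and let $T=T^*\ge 0$ be a (possibly unbounded) non-negative self-adjoint operator in $\mathcal H$ with domain $\operatorname{dom}(T)$. Let $W^{2,2}(\mathbb R_+,\mathcal H)$ be the space of $f\in L^2(\mathbb R_+,\mathcal H)$, $\mathbb R_+=(0,\infty)$, whose weak derivatives $f',f''$ belong to $L^2(\mathbb R_+,\mathcal H)$, and let $$W^{2,2}_T(\mathbb R_+,\mathcal H)=\{f\in W^{2,2}(\mathbb R_+,\mathcal H): f(t)\in\operatorname{dom}(T)\text{ for a.e. }t,\ Tf\in L^2(\mathbb R_+,\mathcal H)\},$$ $$\|f\|_{W^{2,2}_T}^2=\int_{\mathbb R_+}\bigl(\|f''(t)\|^2+\|f(t)\|^2+\|Tf(t)\|^2\bigr)\,dt .$$ Let $W^{2,2}_{0,T}(\mathbb R_+,\mathcal H)=\{f\in W^{2,2}_T(\mathbb R_+,\mathcal H): f(0)=f'(0)=0\}$, where boundary values are those of the continuous representatives on $[0,\infty)$, with the norm of $W^{2,2}_T(\mathbb R_+,\mathcal H)$. Let $\mathcal D_0$ be the set of finite sums $\sum_j\phi_j(\cdot)h_j$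 with $h_j\in\operatorname{dom}(T)$ and scalar functions $\phi_j\in W^{2,2}(\mathbb R_+)$ satisfying $\phi_j(0)=\phi_j'(0)=0$, and let $A'f=-f''+Tf$ for $f\in\mathcal D_0$, an operator in $L^2(\mathbb R_+,\mathcal H)$. Then $A'$ is closable, and the domain of its closure $A_{\min}=\overline{A'}$, equipped with the graph norm $(\|f\|^2+\|A_{\min}f\|^2)^{1/2}$, coincides algebraically and topologically with $W^{2,2}_{0,T}(\mathbb R_+,\mathcal H)$: $\operatorname{dom}(A_{\min})=W^{2,2}_{0,T}(\mathbb R_+,\mathcal H)$ as sets, and on this space the graph norm and the norm $\|\cdot\|_{W^{2,2}_T}$ are equivalent. -/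

import Mathlib

open MeasureTheory Set
open scoped ContDiff

noncomputable section

namespace SturmLiouville

/-- The Hilbert space `L²(ℝ₊, E)` of (classes of) square integrable functions on `(0, ∞)`. -/
abbrev L2 (E : Type*) [NormedAddCommGroup E] : Type _ :=
  Lp E 2 (volume.restrict (Ioi (0 : ℝ)))

section Sobolev

variable {E : Type*} [NormedAddCommGroup E] [NormedSpace ℂ E]

/-- `g` is the weak derivative of `f` on `(0, ∞)`: `∫ φ' f = - ∫ φ g` for all `φ ∈ C_c^∞(0, ∞)`. -/
def HasWeakDeriv (f g : L2 E) : Prop :=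
  ∀ φ : ℝ → ℝ, ContDiff ℝ ∞ φ → HasCompactSupport φ → tsupport φ ⊆ Ioi 0 →
    ∫ t in Ioi (0 : ℝ), deriv φ t • f t = - ∫ t in Ioi (0 : ℝ), φ t • g t

theorem integrable_test_smul {φ : ℝ → ℝ} (hφ : Continuous φ) (hc : HasCompactSupport φ)
    (f : L2 E) : Integrable (fun t => φ t • f t) (volume.restrict (Ioi (0 : ℝ))) := by
  have h : MemLp (φ • (f : ℝ → E)) 1 (volume.restrict (Ioi (0 : ℝ))) :=
    (Lp.memLp f).smul (p := 2) (hφ.memLp_of_hasCompactSupport hc)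
  exact memLp_one_iff_integrable.1 h

theorem HasWeakDeriv.zero : HasWeakDeriv (0 : L2 E) 0 := by
  intro φ _ _ _
  have h0 := Lp.coeFn_zero E 2 (volume.restrict (Ioi (0 : ℝ)))
  rw [integral_eq_zero_of_ae, integral_eq_zero_of_ae, neg_zero] <;>
    filter_upwards [h0] with t ht <;> rw [ht] <;> simp

theorem HasWeakDeriv.add {f g f' g' : L2 E} (h : HasWeakDeriv f g) (h' : HasWeakDeriv f' g') :
    HasWeakDeriv (f + f') (g + g') := by
  intro φ h1 h2 h3
  have e1 : ∫ t in Ioi (0 : ℝ), deriv φ t • (f + f') t =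
      ∫ t in Ioi (0 : ℝ), (deriv φ t • f t + deriv φ t • f' t) := by
    apply integral_congr_ae
    filter_upwards [Lp.coeFn_add f f'] with t ht
    rw [ht, Pi.add_apply, smul_add]
  have e2 : ∫ t in Ioi (0 : ℝ), φ t • (g + g') t =
      ∫ t in Ioi (0 : ℝ), (φ t • g t + φ t • g' t) := by
    apply integral_congr_ae
    filter_upwards [Lp.coeFn_add g g'] with t ht
    rw [ht, Pi.add_apply, smul_add]
  have hd : Continuous (deriv φ) := h1.continuous_deriv (by simp)
  rw [e1, e2, integral_add (integrable_test_smul hd h2.deriv f)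
    (integrable_test_smul hd h2.deriv f'), integral_add (integrable_test_smul h1.continuous h2 g)
    (integrable_test_smul h1.continuous h2 g'), h φ h1 h2 h3, h' φ h1 h2 h3]
  abel

theorem HasWeakDeriv.smul {f g : L2 E} (c : ℂ) (h : HasWeakDeriv f g) :
    HasWeakDeriv (c • f) (c • g) := by
  intro φ h1 h2 h3
  have e1 : ∫ t in Ioi (0 : ℝ), deriv φ t • (c • f) t =
      ∫ t in Ioi (0 : ℝ), c • (deriv φ t • f t) := by
    apply integral_congr_ae
    filter_upwards [Lp.coeFn_smul c f] with t ht
    rw [ht, Pi.smul_apply, smul_comm]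
  have e2 : ∫ t in Ioi (0 : ℝ), φ t • (c • g) t = ∫ t in Ioi (0 : ℝ), c • (φ t • g t) := by
    apply integral_congr_ae
    filter_upwards [Lp.coeFn_smul c g] with t ht
    rw [ht, Pi.smul_apply, smul_comm]
  rw [e1, e2, integral_smul, integral_smul, h φ h1 h2 h3, smul_neg]

theorem HasWeakDeriv.eq_zero [CompleteSpace E] {f g : L2 E} (h : HasWeakDeriv f g) (hf : f = 0) :
    g = 0 := by
  subst hf
  have hg : LocallyIntegrableOn g (Ioi (0 : ℝ)) volume :=
    locallyIntegrableOn_of_locallyIntegrable_restrict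
      ((Lp.memLp g).locallyIntegrable (by norm_num))
  have key := isOpen_Ioi.ae_eq_zero_of_integral_contDiff_smul_eq_zero hg (fun φ h1 h2 h3 => by
    have := h φ h1 h2 h3
    rw [integral_eq_zero_of_ae] at this
    · rw [← setIntegral_eq_integral_of_forall_compl_eq_zero (s := Ioi (0 : ℝ))]
      · simpa using this.symm
      · intro x hx
        rw [image_eq_zero_of_notMem_tsupport (fun hx' => hx (h3 hx')), zero_smul]
    · filter_upwards [Lp.coeFn_zero E 2 (volume.restrict (Ioi (0 : ℝ)))] with t ht
      rw [ht]
      simp)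
  rw [Lp.eq_zero_iff_ae_eq_zero]
  exact (ae_restrict_iff' measurableSet_Ioi).2 key

/-- The graph of the second weak derivative `f ↦ f''` on
`W^{2,2}(ℝ₊, E) = {f ∈ L² : f', f'' ∈ L²}`. -/
def secondDerivGraph (E : Type*) [NormedAddCommGroup E] [NormedSpace ℂ E] :
    Submodule ℂ (L2 E × L2 E) where
  carrier := {p | ∃ f₁ : L2 E, HasWeakDeriv p.1 f₁ ∧ HasWeakDeriv f₁ p.2}
  zero_mem' := ⟨0, HasWeakDeriv.zero, HasWeakDeriv.zero⟩
  add_mem' := by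
    rintro p q ⟨f₁, h₁, h₂⟩ ⟨g₁, k₁, k₂⟩
    exact ⟨f₁ + g₁, h₁.add k₁, h₂.add k₂⟩
  smul_mem' := by
    rintro c p ⟨f₁, h₁, h₂⟩
    exact ⟨c • f₁, h₁.smul c, h₂.smul c⟩

/-- The operator `f ↦ f''` in `L²(ℝ₊, E)`, with domain `W^{2,2}(ℝ₊, E)`. -/
def secondDeriv (E : Type*) [NormedAddCommGroup E] [NormedSpace ℂ E] : L2 E →ₗ.[ℂ] L2 E :=
  (secondDerivGraph E).toLinearPMap

theorem secondDeriv_graph [CompleteSpace E] : (secondDeriv E).graph = secondDerivGraph E := by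
  apply Submodule.toLinearPMap_graph_eq
  rintro p ⟨f₁, h₁, h₂⟩ hp
  exact h₂.eq_zero (h₁.eq_zero hp)

/-- The continuous representative of `f` on `[0, ∞)` exists and has the value `a` at `0`. -/
def HasBoundaryValue (f : L2 E) (a : E) : Prop :=
  ∃ g : ℝ → E, ContinuousOn g (Ici 0) ∧ f =ᵐ[volume.restrict (Ioi (0 : ℝ))] g ∧ g 0 = a

/-- `W^{2,2}_0(ℝ₊, E) = {f ∈ W^{2,2}(ℝ₊, E) : f(0) = f'(0) = 0}`. -/
def W22Zero (E : Type*) [NormedAddCommGroup E] [NormedSpace ℂ E] : Submodule ℂ (L2 E) where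
  carrier := {f | ∃ f₁ f₂ : L2 E, HasWeakDeriv f f₁ ∧ HasWeakDeriv f₁ f₂ ∧
    HasBoundaryValue f 0 ∧ HasBoundaryValue f₁ 0}
  zero_mem' := by
    have h0 : HasBoundaryValue (0 : L2 E) 0 :=
      ⟨fun _ => 0, continuousOn_const, Lp.coeFn_zero E 2 _, rfl⟩
    exact ⟨0, 0, HasWeakDeriv.zero, HasWeakDeriv.zero, h0, h0⟩
  add_mem' := by
    have hadd : ∀ f g : L2 E, HasBoundaryValue f 0 → HasBoundaryValue g 0 →
        HasBoundaryValue (f + g) 0 := by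
      rintro f g ⟨u, hu, hfu, hu0⟩ ⟨v, hv, hgv, hv0⟩
      refine ⟨u + v, hu.add hv, (Lp.coeFn_add f g).trans (hfu.add hgv), by simp [hu0, hv0]⟩
    rintro f g ⟨f₁, f₂, h₁, h₂, h₃, h₄⟩ ⟨g₁, g₂, k₁, k₂, k₃, k₄⟩
    exact ⟨f₁ + g₁, f₂ + g₂, h₁.add k₁, h₂.add k₂, hadd _ _ h₃ k₃, hadd _ _ h₄ k₄⟩
  smul_mem' := by
    have hsmul : ∀ (c : ℂ) (f : L2 E), HasBoundaryValue f 0 → HasBoundaryValue (c • f) 0 := by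
      rintro c f ⟨u, hu, hfu, hu0⟩
      refine ⟨c • u, hu.const_smul c, (Lp.coeFn_smul c f).trans (hfu.const_smul c), by simp [hu0]⟩
    rintro c f ⟨f₁, f₂, h₁, h₂, h₃, h₄⟩
    exact ⟨c • f₁, c • f₂, h₁.smul c, h₂.smul c, hsmul c _ h₃, hsmul c _ h₄⟩

/-- The function `t ↦ φ(t) h`, for a scalar function `φ` and a vector `h`. -/
def tensor (φ : L2 ℂ) (h : E) : L2 E :=
  (ContinuousLinearMap.toSpanSingleton ℂ h).compLp φ

theorem coeFn_tensor (φ : L2 ℂ) (h : E) :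
    tensor φ h =ᵐ[volume.restrict (Ioi (0 : ℝ))] fun t => φ t • h := by
  filter_upwards [(ContinuousLinearMap.toSpanSingleton ℂ h).coeFn_compLp φ] with t ht
  simpa [tensor] using ht

theorem HasWeakDeriv.tensor [CompleteSpace E] {φ ψ : L2 ℂ} (hφ : HasWeakDeriv φ ψ) (h : E) :
    HasWeakDeriv (SturmLiouville.tensor φ h) (SturmLiouville.tensor ψ h) := by
  have aux : ∀ (χ : ℝ → ℝ) (u : L2 ℂ),
      ∫ t in Ioi (0 : ℝ), χ t • SturmLiouville.tensor u h t =
        (∫ t in Ioi (0 : ℝ), χ t • u t) • h := by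
    intro χ u
    rw [← integral_smul_const]
    apply integral_congr_ae
    filter_upwards [coeFn_tensor u h] with t ht
    rw [ht, smul_assoc]
  intro χ h1 h2 h3
  rw [aux, aux, hφ χ h1 h2 h3, neg_smul]

end Sobolev

variable {H : Type*} [NormedAddCommGroup H] [InnerProductSpace ℂ H]

/-- The graph of multiplication by `T`: pairs `(f, g)` with `f(t) ∈ dom T`, `g(t) = T f(t)` a.e. -/
def pointwiseGraph (T : H →ₗ.[ℂ] H) : Submodule ℂ (L2 H × L2 H) where
  carrier := {p | ∀ᵐ t ∂(volume.restrict (Ioi (0 : ℝ))), (p.1 t, p.2 t) ∈ T.graph}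
  zero_mem' := by
    change ∀ᵐ t ∂(volume.restrict (Ioi (0 : ℝ))), ((0 : L2 H) t, (0 : L2 H) t) ∈ T.graph
    filter_upwards [Lp.coeFn_zero H 2 (volume.restrict (Ioi (0 : ℝ)))] with t ht
    rw [ht]
    exact T.graph.zero_mem
  add_mem' := by
    intro p q hp hq
    change ∀ᵐ t ∂(volume.restrict (Ioi (0 : ℝ))), ((p.1 + q.1) t, (p.2 + q.2) t) ∈ T.graph
    filter_upwards [hp, hq, Lp.coeFn_add p.1 q.1, Lp.coeFn_add p.2 q.2] with t h1 h2 h3 h4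
    rw [h3, h4]
    exact T.graph.add_mem h1 h2
  smul_mem' := by
    intro c p hp
    change ∀ᵐ t ∂(volume.restrict (Ioi (0 : ℝ))), ((c • p.1) t, (c • p.2) t) ∈ T.graph
    filter_upwards [hp, Lp.coeFn_smul c p.1, Lp.coeFn_smul c p.2] with t h1 h3 h4
    rw [h3, h4]
    exact T.graph.smul_mem c h1

/-- The operator `(T f)(t) = T (f(t))` in `L²(ℝ₊, H)`; its domain is `L²(ℝ₊, H₁(T))`, where
`H₁(T)` is `dom T` with the graph norm. -/
def pointwise (T : H →ₗ.[ℂ] H) : L2 H →ₗ.[ℂ] L2 H :=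
  (pointwiseGraph T).toLinearPMap

theorem pointwise_graph (T : H →ₗ.[ℂ] H) : (pointwise T).graph = pointwiseGraph T := by
  apply Submodule.toLinearPMap_graph_eq
  intro p hp h0
  rw [Lp.eq_zero_iff_ae_eq_zero] at h0 ⊢
  have hp' : ∀ᵐ t ∂(volume.restrict (Ioi (0 : ℝ))), (p.1 t, p.2 t) ∈ T.graph := hp
  filter_upwards [hp', h0] with t h1 h2
  exact T.graph_fst_eq_zero_snd h1 h2

/-- `W^{2,2}_T(ℝ₊, H) = W^{2,2}(ℝ₊, H) ∩ L²(ℝ₊, H₁(T))`. -/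
def W22 (T : H →ₗ.[ℂ] H) : Submodule ℂ (L2 H) :=
  (secondDeriv H).domain ⊓ (pointwise T).domain

/-- `‖f‖² = ∫ (‖f''(t)‖² + ‖f(t)‖² + ‖T f(t)‖²) dt` on `W^{2,2}_T(ℝ₊, H)`. -/
def W22.norm (T : H →ₗ.[ℂ] H) (f : W22 T) : ℝ :=
  √(‖secondDeriv H ⟨f, f.2.1⟩‖ ^ 2 + ‖(f : L2 H)‖ ^ 2 + ‖pointwise T ⟨f, f.2.2⟩‖ ^ 2)

/-- `W^{2,2}_{0,T}(ℝ₊, H) = {f ∈ W^{2,2}_T(ℝ₊, H) : f(0) = f'(0) = 0}`. -/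
def W22ZeroT (T : H →ₗ.[ℂ] H) : Submodule ℂ (L2 H) :=
  W22 T ⊓ W22Zero H

/-- The differential expression `𝒜 = -d²/dt² + T`, on `W^{2,2}_T(ℝ₊, H)`. -/
def expression (T : H →ₗ.[ℂ] H) : L2 H →ₗ.[ℂ] L2 H :=
  -secondDeriv H + pointwise T

/-- `𝒟₀`: finite sums `∑ φⱼ(t) hⱼ` with `φⱼ ∈ W^{2,2}_0(ℝ₊)` and `hⱼ ∈ dom T`. -/
def D₀ (T : H →ₗ.[ℂ] H) : Submodule ℂ (L2 H) :=
  Submodule.span ℂ {f | ∃ φ ∈ W22Zero ℂ, ∃ h ∈ T.domain, f = tensor φ h}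

/-- The expression `𝒜` is defined on all of `𝒟₀`, so that restricting it to `𝒟₀` loses nothing. -/
theorem D₀_le [CompleteSpace H] (T : H →ₗ.[ℂ] H) : D₀ T ≤ (expression T).domain := by
  refine Submodule.span_le.2 ?_
  rintro f ⟨φ, ⟨φ₁, φ₂, h₁, h₂, -, -⟩, h, hh, rfl⟩
  refine ⟨⟨(tensor φ h, tensor φ₂ h), ⟨tensor φ₁ h, h₁.tensor h, h₂.tensor h⟩, rfl⟩,
    ⟨(tensor φ h, tensor φ (T ⟨h, hh⟩)), ?_, rfl⟩⟩
  change ∀ᵐ t ∂(volume.restrict (Ioi (0 : ℝ))),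
    (tensor φ h t, tensor φ (T ⟨h, hh⟩) t) ∈ T.graph
  filter_upwards [coeFn_tensor φ h, coeFn_tensor φ (T ⟨h, hh⟩)] with t e1 e2
  rw [e1, e2]
  exact T.graph.smul_mem (φ t) (T.mem_graph ⟨h, hh⟩)

/-- `A' = 𝒜 ↾ 𝒟₀`. -/
def preminimal (T : H →ₗ.[ℂ] H) : L2 H →ₗ.[ℂ] L2 H :=
  (expression T).domRestrict (D₀ T)

/-- The minimal operator `A_min`, the closure of `A'`. -/
def minimal (T : H →ₗ.[ℂ] H) : L2 H →ₗ.[ℂ] L2 H :=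
  (preminimal T).closure

/-- The graph norm `(‖f‖² + ‖A f‖²)^{1/2}` on the domain of an operator `A`. -/
def graphNorm {F : Type*} [NormedAddCommGroup F] [NormedSpace ℂ F] (A : F →ₗ.[ℂ] F)
    (f : A.domain) : ℝ :=
  √(‖(f : F)‖ ^ 2 + ‖A f‖ ^ 2)

end SturmLiouville

end

/-! The theorem rests on one estimate and one density result. For `f = ∑ φⱼ hⱼ` in `D₀`, the
function `Tf` is the primitive of `Tf'`, so integration by parts gives `-⟨Tf, f''⟩ = ⟨Tf', f'⟩`,
whose real part is nonnegative. Expanding the square yields `‖f''‖² + ‖Tf‖² ≤ ‖-f'' + Tf‖²`. By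
density of `D₀` the estimate holds on all of `W^{2,2}_{0,T}`, where it is the nontrivial half of the
norm equivalence. The triples `(f, f'', Tf)` form a closed space, so the estimate also makes the
graph of `-f'' + Tf` on `W^{2,2}_{0,T}` closed; by density it is the closure of the graph of `A'`.

Density (`tripleGraph_le_closure`) needs no spectral theorem. Let `(g, g'', Tg)` be orthogonal to
all `(φh, φ''h, φTh)`. Taking `h = Sk` with `S = (1 + T*T)⁻¹` gives `⟨φk, g⟩ + ⟨φ''k, S*g''⟩ = 0`
for every `k`. The pairs `(φk, φ''k)` are dense in the graph of the second derivative on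
`W^{2,2}_0`, so `(g, g'')` may be inserted: `‖g‖² + ⟨g'', S*g''⟩ = 0`. As `S ≥ 0`, `g = 0`.

Weak derivatives with zero boundary value are handled as primitives (`IsPrimitive`), a relation
closed in `L²` and preserved by bounded operators; the du Bois-Reymond lemma identifies the two
notions. -/

noncomputable section

namespace SturmLiouville

open Filter Topology

/-! ### Primitives of square integrable functions. -/

section Primitive

/-- Integration by parts for products of primitives of integrable functions, paired by a
continuous bilinear map. -/
theorem setIntegral_bilin_primitive {E F G : Type*} [NormedAddCommGroup E] [NormedSpace ℝ E]
    [CompleteSpace E] [NormedAddCommGroup F] [NormedSpace ℝ F] [CompleteSpace F]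
    [NormedAddCommGroup G] [NormedSpace ℝ G] [CompleteSpace G]
    (B : E →L[ℝ] F →L[ℝ] G) {p : ℝ → E} {q : ℝ → F} {R : ℝ}
    (hp : IntegrableOn p (Ioc 0 R)) (hq : IntegrableOn q (Ioc 0 R)) :
    (∫ t in Ioc 0 R, B (p t) (∫ s in Ioc 0 t, q s)) +
        ∫ t in Ioc 0 R, B (∫ s in Ioc 0 t, p s) (q t) =
      B (∫ t in Ioc 0 R, p t) (∫ t in Ioc 0 R, q t) := by
  set μ : Measure ℝ := volume.restrict (Ioc 0 R) with hμ
  have hint : Integrable (fun z : ℝ × ℝ => B (p z.1) (q z.2)) (μ.prod μ) :=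
    hp.op_fst_snd (by fun_prop) ⟨‖B‖, B.le_opNorm₂⟩ hq
  -- Fubini: the integral over the square is split along the diagonal, and each triangle gives one
  -- term on the left.
  have hA : MeasurableSet {z : ℝ × ℝ | z.2 ≤ z.1} := measurableSet_le measurable_snd measurable_fst
  rw [← integral_prod_bilin B hp hq, ← integral_add_compl hA hint, ← integral_indicator hA,
    ← integral_indicator hA.compl, integral_prod _ (hint.indicator hA),
    integral_prod_symm _ (hint.indicator hA.compl)]
  congr 1
  · refine setIntegral_congr_fun measurableSet_Ioc fun t ht => ?_
    have : ∀ s, {z : ℝ × ℝ | z.2 ≤ z.1}.indicator (fun z => B (p z.1) (q z.2)) (t, s) =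
        (Iic t).indicator (fun s => B (p t) (q s)) s := fun s => by
      simp [indicator]
    simp only [this]
    rw [integral_indicator measurableSet_Iic, hμ, Measure.restrict_restrict measurableSet_Iic,
      Iic_inter_Ioc_of_le ht.2,
      ContinuousLinearMap.integral_comp_comm _ (hq.mono_set (Ioc_subset_Ioc_right ht.2))]
  · refine setIntegral_congr_fun measurableSet_Ioc fun t ht => ?_
    have : ∀ s, {z : ℝ × ℝ | z.2 ≤ z.1}ᶜ.indicator (fun z => B (p z.1) (q z.2)) (s, t) =
        (Iio t).indicator (fun s => B.flip (q t) (p s)) s := fun s => by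
      simp [indicator]
    simp only [this]
    have hset : Iio t ∩ Ioc 0 R = Ioo 0 t := by
      ext s
      simp only [mem_inter_iff, mem_Iio, mem_Ioc, mem_Ioo]
      exact ⟨fun h => ⟨h.2.1, h.1⟩, fun h => ⟨h.2, h.1, h.2.le.trans ht.2⟩⟩
    rw [integral_indicator measurableSet_Iio, hμ, Measure.restrict_restrict measurableSet_Iio,
      hset, ← integral_Ioc_eq_integral_Ioo,
      ContinuousLinearMap.integral_comp_comm _ (hp.mono_set (Ioc_subset_Ioc_right ht.2))]
    simp

variable {E : Type*} [NormedAddCommGroup E]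

theorem integrableOn_Ioc (f : L2 E) (t : ℝ) : IntegrableOn f (Ioc 0 t) := by
  have h : MemLp f 2 (volume.restrict (Ioc 0 t)) :=
    (Lp.memLp f).mono_measure (Measure.restrict_mono_set _ Ioc_subset_Ioi_self)
  exact h.integrable (by norm_num)

theorem intervalIntegrable_L2 (f : L2 E) {t : ℝ} (ht : 0 ≤ t) :
    IntervalIntegrable f volume 0 t :=
  (intervalIntegrable_iff_integrableOn_Ioc_of_le ht).2 (integrableOn_Ioc f t)

variable [NormedSpace ℂ E]

theorem continuousOn_primitive (f : L2 E) :
    ContinuousOn (fun t => ∫ s in (0 : ℝ)..t, f s) (Ici 0) := by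
  intro t ht
  have h := intervalIntegral.continuousOn_primitive_interval'
    (intervalIntegrable_L2 f (zero_le_one.trans (le_add_of_nonneg_left ht))) left_mem_uIcc
  rw [uIcc_of_le (by linarith [mem_Ici.1 ht])] at h
  refine (h t ⟨ht, by linarith⟩).mono_of_mem_nhdsWithin ?_
  filter_upwards [self_mem_nhdsWithin, mem_nhdsWithin_of_mem_nhds (Iic_mem_nhds (lt_add_one t))]
    with s h1 h2 using ⟨h1, h2⟩

/-- Integration over a bounded interval is continuous on `L²`. -/
theorem tendsto_primitive {ι : Type*} {l : Filter ι} {g : ι → L2 E} {g₀ : L2 E}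
    (h : Tendsto g l (𝓝 g₀)) (t : ℝ) :
    Tendsto (fun n => ∫ s in Ioc 0 t, g n s) l (𝓝 (∫ s in Ioc 0 t, g₀ s)) := by
  refine tendsto_integral_of_L1' _ (integrableOn_Ioc g₀ t).aestronglyMeasurable
    (Eventually.of_forall fun n => integrableOn_Ioc (g n) t) ?_
  rw [Lp.tendsto_Lp_iff_tendsto_eLpNorm'] at h
  have h2 : Tendsto (fun n => eLpNorm (⇑(g n) - ⇑g₀) 2 (volume.restrict (Ioi (0 : ℝ))) *
      (volume.restrict (Ioc 0 t)) univ ^ (1 / ENNReal.toReal 1 - 1 / ENNReal.toReal 2))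
      l (𝓝 0) := by
    have := ENNReal.Tendsto.mul_const (b := (volume.restrict (Ioc 0 t)) univ ^
      (1 / ENNReal.toReal 1 - 1 / ENNReal.toReal 2)) h (Or.inr (by
        refine ENNReal.rpow_ne_top_of_nonneg (by norm_num) (by simp)))
    simpa using this
  refine tendsto_of_tendsto_of_tendsto_of_le_of_le tendsto_const_nhds h2 (fun _ => zero_le)
    fun n => ?_
  have hle : volume.restrict (Ioc 0 t) ≤ volume.restrict (Ioi (0 : ℝ)) :=
    Measure.restrict_mono_set _ Ioc_subset_Ioi_self
  have hm : AEStronglyMeasurable (⇑(g n) - ⇑g₀) (volume.restrict (Ioi (0 : ℝ))) :=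
    (Lp.aestronglyMeasurable _).sub (Lp.aestronglyMeasurable _)
  refine (eLpNorm_le_eLpNorm_mul_rpow_measure_univ one_le_two (hm.mono_measure hle)).trans ?_
  gcongr

/-- `f` is the primitive of `g` that vanishes at `0`. -/
def IsPrimitive (f g : L2 E) : Prop :=
  ∀ᵐ t ∂(volume.restrict (Ioi (0 : ℝ))), f t = ∫ s in Ioc 0 t, g s

/-- Along a subsequence the left sides converge almost everywhere, while the integrals over `Ioc 0
t` converge for every `t`. -/
theorem isClosed_isPrimitive : IsClosed {p : L2 E × L2 E | IsPrimitive p.1 p.2} := by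
  refine IsSeqClosed.isClosed fun u p hu hp => ?_
  have h1 : Tendsto (fun n => (u n).1) atTop (𝓝 p.1) := (continuous_fst.tendsto p).comp hp
  have h2 : Tendsto (fun n => (u n).2) atTop (𝓝 p.2) := (continuous_snd.tendsto p).comp hp
  obtain ⟨ns, hns, hae⟩ := (tendstoInMeasure_of_tendsto_Lp h1).exists_seq_tendsto_ae
  have hu' : ∀ᵐ t ∂(volume.restrict (Ioi (0 : ℝ))), ∀ n,
      (u n).1 t = ∫ s in Ioc 0 t, (u n).2 s := ae_all_iff.2 hu
  filter_upwards [hae, hu'] with t h3 h4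
  simp only [h4] at h3
  exact tendsto_nhds_unique h3 ((tendsto_primitive h2 t).comp hns.tendsto_atTop)

theorem IsPrimitive.compLp [CompleteSpace E] {F : Type*} [NormedAddCommGroup F] [NormedSpace ℂ F]
    [CompleteSpace F] (L : E →L[ℂ] F) {f g : L2 E} (h : IsPrimitive f g) :
    IsPrimitive (L.compLp f) (L.compLp g) := by
  filter_upwards [h, L.coeFn_compLp f] with t h1 h2
  rw [h2, h1, ← ContinuousLinearMap.integral_comp_comm _ (integrableOn_Ioc g t)]
  refine integral_congr_ae (Filter.EventuallyEq.symm ?_)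
  exact ae_mono (Measure.restrict_mono_set _ Ioc_subset_Ioi_self) (L.coeFn_compLp g)

theorem IsPrimitive.zero : IsPrimitive (0 : L2 E) 0 := by
  filter_upwards [Lp.coeFn_zero E 2 (volume.restrict (Ioi (0 : ℝ)))] with t ht
  rw [ht, integral_eq_zero_of_ae]
  · rfl
  · exact ae_mono (Measure.restrict_mono_set _ Ioc_subset_Ioi_self)
      (Lp.coeFn_zero E 2 (volume.restrict (Ioi (0 : ℝ))))

theorem IsPrimitive.add {f g f' g' : L2 E} (h : IsPrimitive f g) (h' : IsPrimitive f' g') :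
    IsPrimitive (f + f') (g + g') := by
  filter_upwards [h, h', Lp.coeFn_add f f'] with t h1 h2 h3
  rw [h3, Pi.add_apply, h1, h2, ← integral_add (integrableOn_Ioc g t) (integrableOn_Ioc g' t)]
  exact integral_congr_ae (Filter.EventuallyEq.symm
    (ae_mono (Measure.restrict_mono_set _ Ioc_subset_Ioi_self) (Lp.coeFn_add g g')))

theorem IsPrimitive.smul {f g : L2 E} (c : ℂ) (h : IsPrimitive f g) :
    IsPrimitive (c • f) (c • g) := by
  filter_upwards [h, Lp.coeFn_smul c f] with t h1 h3
  rw [h3, Pi.smul_apply, h1, ← integral_smul]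
  exact integral_congr_ae (Filter.EventuallyEq.symm
    (ae_mono (Measure.restrict_mono_set _ Ioc_subset_Ioi_self) (Lp.coeFn_smul c g)))

end Primitive

/-! ### Integration by parts on the half-line. -/

section IntegrationByParts

variable {H : Type*} [NormedAddCommGroup H] [InnerProductSpace ℂ H] [CompleteSpace H]

/-- Integration by parts in `L²(ℝ₊, H)`, for functions vanishing at `0`. -/
theorem IsPrimitive.inner_eq_neg {f f' g g' : L2 H} (hf : IsPrimitive f f')
    (hg : IsPrimitive g g') : inner ℂ f' g = - inner ℂ f g' := by
  set μ := volume.restrict (Ioi (0 : ℝ))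
  let B : H →L[ℝ] H →L[ℝ] ℂ := isBoundedBilinearMap_inner (𝕜 := ℂ) (E := H)
    |>.toContinuousLinearMap
  have hB : ∀ x y, B x y = inner ℂ x y := fun x y => rfl
  have i1 : Integrable (fun t => inner ℂ (f' t) (g t)) μ := L2.integrable_inner f' g
  have i2 : Integrable (fun t => inner ℂ (f t) (g' t)) μ := L2.integrable_inner f g'
  have i3 : Integrable (fun t => inner ℂ (f t) (g t)) μ := L2.integrable_inner f g
  let P : ℝ → ℂ := fun R => inner ℂ (∫ s in Ioc 0 R, f' s) (∫ s in Ioc 0 R, g' s)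
  have hP : P =ᵐ[μ] fun t => inner ℂ (f t) (g t) := by
    filter_upwards [hf, hg] with t h1 h2
    rw [h1, h2]
  have hPint : IntegrableOn P (Ioi 0) := i3.congr hP.symm
  have key : ∀ R, P R = ∫ t in Ioc 0 R, (inner ℂ (f' t) (g t) + inner ℂ (f t) (g' t)) := by
    intro R
    have hle : volume.restrict (Ioc 0 R) ≤ μ :=
      Measure.restrict_mono_set _ Ioc_subset_Ioi_self
    have := setIntegral_bilin_primitive B (integrableOn_Ioc f' R) (integrableOn_Ioc g' R)
    simp only [hB] at this
    rw [integral_add (i1.mono_measure hle) (i2.mono_measure hle)]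
    refine this.symm.trans ?_
    congr 1 <;> refine integral_congr_ae ?_
    · filter_upwards [ae_mono hle hg] with t ht
      rw [ht]
    · filter_upwards [ae_mono hle hf] with t ht
      rw [ht]
  have hlim : Tendsto P atTop
      (𝓝 (∫ t in Ioi (0 : ℝ), (inner ℂ (f' t) (g t) + inner ℂ (f t) (g' t)))) := by
    refine (intervalIntegral_tendsto_integral_Ioi 0 (i1.add i2) tendsto_id).congr' ?_
    filter_upwards [eventually_ge_atTop 0] with R hR
    rw [key R, id, intervalIntegral.integral_of_le hR]
    rfl
  -- The boundary term `P` is integrable and has a limit at infinity; the limit must be zero because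
  -- neighbourhoods of infinity have infinite measure.
  have hzero := IntegrableAtFilter.eq_zero_of_tendsto (l := atTop) (μ := volume)
    ⟨Ioi 0, Ioi_mem_atTop 0, hPint⟩ (fun s hs => by
      obtain ⟨a, ha⟩ := mem_atTop_sets.1 hs
      rw [← top_le_iff]
      calc (⊤ : ENNReal) = volume (Ici a) := by simp
        _ ≤ volume s := measure_mono ha) hlim
  rw [integral_add i1 i2] at hzero
  rw [L2.inner_def, L2.inner_def]
  exact eq_neg_of_add_eq_zero_left hzero

/-- Integration by parts gives `‖f'‖² = -⟨f, f''⟩`. Hence `f'` is controlled by `f` and `f''` and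
need not appear in the norms. -/
theorem IsPrimitive.norm_sq_le {f f₁ f₂ : L2 H} (h₁ : IsPrimitive f f₁)
    (h₂ : IsPrimitive f₁ f₂) : ‖f₁‖ ^ 2 ≤ ‖f‖ * ‖f₂‖ := by
  have h := h₁.inner_eq_neg h₂
  rw [inner_self_eq_norm_sq_to_K] at h
  calc ‖f₁‖ ^ 2 = ‖((‖f₁‖ : ℂ)) ^ 2‖ := by simp
    _ = ‖(inner ℂ f f₂ : ℂ)‖ := by rw [← norm_neg (inner ℂ f f₂), ← h]; rfl
    _ ≤ ‖f‖ * ‖f₂‖ := norm_inner_le_norm _ _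

end IntegrationByParts

/-! ### Weak derivatives with zero boundary value are primitives. -/

section DuBoisReymond

/-- A smooth function with compact support in `(0, ∞)` and integral zero is the derivative of
such a function. -/
theorem exists_deriv_eq_of_integral_eq_zero {χ : ℝ → ℝ} (h1 : ContDiff ℝ ∞ χ)
    (h2 : HasCompactSupport χ) (h3 : tsupport χ ⊆ Ioi 0) (h4 : ∫ t, χ t = 0) :
    ∃ φ : ℝ → ℝ, ContDiff ℝ ∞ φ ∧ HasCompactSupport φ ∧ tsupport φ ⊆ Ioi 0 ∧ deriv φ = χ := by
  obtain ⟨a, b, ha, hab⟩ : ∃ a b : ℝ, 0 < a ∧ tsupport χ ⊆ Icc a b := by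
    rcases (tsupport χ).eq_empty_or_nonempty with he | hne
    · exact ⟨1, 1, one_pos, by simp [he]⟩
    · obtain ⟨a, ha⟩ := h2.isCompact.exists_isLeast hne
      obtain ⟨b, hb⟩ := h2.isCompact.exists_isGreatest hne
      exact ⟨a, b, h3 ha.1, fun t ht => ⟨ha.2 ht, hb.2 ht⟩⟩
  have hz : ∀ s, s ∉ Icc a b → χ s = 0 := fun s hs =>
    image_eq_zero_of_notMem_tsupport fun h => hs (hab h)
  have hint : Integrable χ := h1.continuous.integrable_of_hasCompactSupport h2
  have hd : ∀ t, HasDerivAt (fun t => ∫ s in (0 : ℝ)..t, χ s) (χ t) t := fun t =>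
    intervalIntegral.integral_hasDerivAt_right hint.intervalIntegrable
      (h1.continuous.stronglyMeasurableAtFilter _ _) h1.continuous.continuousAt
  have hderiv : deriv (fun t => ∫ s in (0 : ℝ)..t, χ s) = χ := funext fun t => (hd t).deriv
  have hsupp : Function.support (fun t => ∫ s in (0 : ℝ)..t, χ s) ⊆ Icc a b := by
    intro t ht
    by_contra hn
    apply ht
    change ∫ s in (0 : ℝ)..t, χ s = 0
    rw [mem_Icc, not_and_or, not_le, not_le] at hn
    rcases hn with hn | hn
    · refine intervalIntegral.integral_zero_ae (Eventually.of_forall fun s hs => hz s fun hs' => ?_)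
      rcases le_total 0 t with h0 | h0
      · rw [uIoc_of_le h0] at hs
        linarith [hs.2, hs'.1]
      · rw [uIoc_of_ge h0] at hs
        linarith [hs.2, hs'.1]
    -- If `b < t < a`, then `Icc a b` is empty and `χ = 0`; otherwise the integral up to `t` is
    -- already the full integral of `χ`.
    · rcases lt_or_ge t a with hta | hta
      · refine intervalIntegral.integral_zero_ae
          (Eventually.of_forall fun s hs => hz s fun hs' => ?_)
        linarith [hs'.1, hs'.2]
      · rw [intervalIntegral.integral_of_le (ha.le.trans hta)]
        refine Eq.trans ?_ h4
        refine setIntegral_eq_integral_of_forall_compl_eq_zero fun s hs => hz s fun hs' => hs ?_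
        exact ⟨ha.trans_le hs'.1, hs'.2.trans hn.le⟩
  have htsupp := closure_minimal hsupp isClosed_Icc
  refine ⟨fun t => ∫ s in (0 : ℝ)..t, χ s, ?_, ?_, ?_, hderiv⟩
  · rw [contDiff_infty_iff_deriv, hderiv]
    exact ⟨fun t => (hd t).differentiableAt, h1⟩
  · exact isCompact_Icc.of_isClosed_subset isClosed_closure htsupp
  · exact htsupp.trans fun t ht => ha.trans_le ht.1

variable {E : Type*} [NormedAddCommGroup E] [NormedSpace ℂ E] [CompleteSpace E]

/-- The lemma of du Bois-Reymond on `(0, ∞)`. -/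
theorem ae_eq_const_of_integral_deriv_smul_eq_zero {w : ℝ → E} (hw : LocallyIntegrable w)
    (h : ∀ φ : ℝ → ℝ, ContDiff ℝ ∞ φ → HasCompactSupport φ → tsupport φ ⊆ Ioi 0 →
      ∫ t, deriv φ t • w t = 0) :
    ∃ c : E, ∀ᵐ t ∂(volume.restrict (Ioi (0 : ℝ))), w t = c := by
  let b : ContDiffBump (1 : ℝ) := ⟨1 / 4, 1 / 2, by norm_num, by norm_num⟩
  let ψ₀ : ℝ → ℝ := b.normed volume
  have hψ₀ : ContDiff ℝ ∞ ψ₀ := b.contDiff_normed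
  have hψ₀c : HasCompactSupport ψ₀ := b.hasCompactSupport_normed
  have hψ₀s : tsupport ψ₀ ⊆ Ioi 0 := by
    intro t ht
    rw [b.tsupport_normed_eq, Real.closedBall_eq_Icc] at ht
    have : (1 : ℝ) - 1 / 2 ≤ t := ht.1
    rw [mem_Ioi]
    linarith
  have hψ₀i : ∫ t, ψ₀ t = 1 := b.integral_normed
  have hI : ∀ ψ : ℝ → ℝ, Continuous ψ → HasCompactSupport ψ → Integrable fun t => ψ t • w t :=
    fun ψ h1 h2 => hw.integrable_smul_left_of_hasCompactSupport h1 h2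
  refine ⟨∫ t, ψ₀ t • w t, ?_⟩
  have key := isOpen_Ioi.ae_eq_zero_of_integral_contDiff_smul_eq_zero (U := Ioi (0 : ℝ))
    (f := fun t => w t - ∫ t, ψ₀ t • w t) (μ := volume)
    ((hw.sub (locallyIntegrable_const _)).locallyIntegrableOn _) (fun ψ h1 h2 h3 => by
      -- Since `ψ₀` has integral one, `ψ - m ψ₀` has integral zero and is an admissible `φ'`.
      -- Testing with `φ` shows that `w - ∫ ψ₀ w` is annihilated by `ψ`.
      set m := ∫ t, ψ t
      have hsub : Function.support (fun t => ψ t - m * ψ₀ t) ⊆ tsupport ψ ∪ tsupport ψ₀ := by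
        intro t ht
        by_contra hn
        rw [mem_union, not_or] at hn
        apply ht
        simp [image_eq_zero_of_notMem_tsupport hn.1, image_eq_zero_of_notMem_tsupport hn.2]
      have hsub' := closure_minimal hsub ((isClosed_tsupport _).union (isClosed_tsupport _))
      have hψi := h1.continuous.integrable_of_hasCompactSupport h2 (μ := volume)
      have hψ₀i' := hψ₀.continuous.integrable_of_hasCompactSupport hψ₀c (μ := volume)
      obtain ⟨φ, k1, k2, k3, k4⟩ := exists_deriv_eq_of_integral_eq_zero
        (χ := fun t => ψ t - m * ψ₀ t) (h1.sub (contDiff_const.mul hψ₀))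
        ((h2.isCompact.union hψ₀c.isCompact).of_isClosed_subset isClosed_closure hsub')
        (hsub'.trans (union_subset h3 hψ₀s)) (by
          rw [integral_sub hψi (hψ₀i'.const_mul m), integral_const_mul, hψ₀i, mul_one, sub_self])
      have h0 := h φ k1 k2 k3
      rw [k4] at h0
      simp only [sub_smul, mul_smul] at h0
      have hm : Integrable fun t => m • ψ₀ t • w t := (hI ψ₀ hψ₀.continuous hψ₀c).smul m
      rw [integral_sub (hI ψ h1.continuous h2) hm,
        integral_smul] at h0
      simp only [smul_sub]
      rw [integral_sub (hI ψ h1.continuous h2) (hψi.smul_const _), integral_smul_const]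
      exact h0)
  filter_upwards [(ae_restrict_iff' measurableSet_Ioi).2 key] with t ht
  exact sub_eq_zero.1 ht

omit [CompleteSpace E] in
theorem continuous_setIntegral_Ioc (g : L2 E) : Continuous fun t => ∫ s in Ioc 0 t, g s := by
  have h := (continuousOn_primitive g).comp_continuous (continuous_id.max continuous_const)
    (fun t => le_max_right t 0)
  refine h.congr fun t => ?_
  rcases le_total 0 t with ht | ht
  · simp [max_eq_left ht, intervalIntegral.integral_of_le ht]
  · simp [ht]

/-- Integration by parts on `(0, R]` with `R` beyond the support of `φ`: the boundary term contains
`φ R = 0`, and `φ 0 = 0` makes `φ` the primitive of `deriv φ`. -/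
theorem integral_deriv_smul_primitive (g : L2 E) {φ : ℝ → ℝ} (h1 : ContDiff ℝ ∞ φ)
    (h2 : HasCompactSupport φ) (h3 : tsupport φ ⊆ Ioi 0) :
    ∫ t in Ioi (0 : ℝ), deriv φ t • (∫ s in Ioc 0 t, g s) = - ∫ t in Ioi (0 : ℝ), φ t • g t := by
  obtain ⟨R, hR0, hR⟩ : ∃ R : ℝ, 0 < R ∧ ∀ t, R ≤ t → t ∉ tsupport φ := by
    obtain ⟨R, hR⟩ := h2.isCompact.bddAbove
    exact ⟨max R 0 + 1, by positivity, fun t ht hs => by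
      linarith [hR hs, le_max_left R 0]⟩
  have hφ : ∀ t, R ≤ t → φ t = 0 := fun t ht => image_eq_zero_of_notMem_tsupport (hR t ht)
  have hφ' : ∀ t, R ≤ t → deriv φ t = 0 := fun t ht =>
    image_eq_zero_of_notMem_tsupport fun h => hR t ht (tsupport_deriv_subset h)
  have hφ0 : φ 0 = 0 := image_eq_zero_of_notMem_tsupport fun h => lt_irrefl (0 : ℝ) (h3 h)
  have hd : Continuous (deriv φ) := h1.continuous_deriv (by simp)
  have hprim : ∀ t, 0 ≤ t → ∫ s in Ioc 0 t, deriv φ s = φ t := fun t ht => by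
    rw [← intervalIntegral.integral_of_le ht, intervalIntegral.integral_deriv_eq_sub
      (fun x _ => (h1.differentiable (by simp)).differentiableAt) (hd.intervalIntegrable _ _),
      hφ0, sub_zero]
  have key := setIntegral_bilin_primitive (ContinuousLinearMap.lsmul ℝ ℝ (E := E))
    (hd.integrableOn_Ioc (a := 0) (b := R)) (integrableOn_Ioc g R)
  simp only [ContinuousLinearMap.lsmul_apply] at key
  rw [hprim R hR0.le, hφ R le_rfl, zero_smul] at key
  rw [eq_neg_iff_add_eq_zero, ← key]
  congr 1
  · refine (setIntegral_eq_of_subset_of_forall_sdiff_eq_zero measurableSet_Ioi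
      Ioc_subset_Ioi_self fun t ht => ?_)
    rw [hφ' t (le_of_not_ge fun h => ht.2 ⟨ht.1, h⟩), zero_smul]
  · rw [setIntegral_congr_fun measurableSet_Ioc (g := fun t => φ t • g t)
      fun t ht => by simp only [hprim t ht.1.le]]
    refine (setIntegral_eq_of_subset_of_forall_sdiff_eq_zero measurableSet_Ioi
      Ioc_subset_Ioi_self fun t ht => ?_)
    rw [hφ t (le_of_not_ge fun h => ht.2 ⟨ht.1, h⟩), zero_smul]

theorem IsPrimitive.hasWeakDeriv {f g : L2 E} (h : IsPrimitive f g) : HasWeakDeriv f g := by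
  intro φ h1 h2 h3
  rw [← integral_deriv_smul_primitive g h1 h2 h3]
  refine integral_congr_ae ?_
  filter_upwards [h] with t ht
  rw [ht]

omit [CompleteSpace E] in
theorem IsPrimitive.hasBoundaryValue {f g : L2 E} (h : IsPrimitive f g) : HasBoundaryValue f 0 :=
  ⟨fun t => ∫ s in Ioc 0 t, g s, (continuous_setIntegral_Ioc g).continuousOn, h, by simp⟩

/-- `f` and the primitive of `g` have the same weak derivative, so they differ by a constant, which
the continuous representative shows to be zero on letting `t → 0`. -/
theorem HasWeakDeriv.isPrimitive {f g : L2 E} (h : HasWeakDeriv f g)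
    (h0 : HasBoundaryValue f 0) : IsPrimitive f g := by
  set G : ℝ → E := fun t => ∫ s in Ioc 0 t, g s with hG
  have hGc : Continuous G := continuous_setIntegral_Ioc g
  have hf : LocallyIntegrable ((Ioi (0 : ℝ)).indicator f) :=
    ((memLp_indicator_iff_restrict measurableSet_Ioi).2 (Lp.memLp f)).locallyIntegrable
      (by norm_num)
  obtain ⟨c, hc⟩ := ae_eq_const_of_integral_deriv_smul_eq_zero
    (w := (Ioi (0 : ℝ)).indicator f - G) (hf.sub hGc.locallyIntegrable) (fun φ h1 h2 h3 => by
      have hd : Continuous (deriv φ) := h1.continuous_deriv (by simp)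
      rw [← setIntegral_eq_integral_of_forall_compl_eq_zero (s := Ioi (0 : ℝ))]
      · rw [setIntegral_congr_fun measurableSet_Ioi
          (g := fun t => deriv φ t • f t - deriv φ t • G t) fun t ht => by
            simp only [Pi.sub_apply, indicator_of_mem ht, smul_sub],
          integral_sub (integrable_test_smul hd h2.deriv f), h φ h1 h2 h3, hG,
          integral_deriv_smul_primitive g h1 h2 h3, sub_self]
        exact (hGc.locallyIntegrable.integrable_smul_left_of_hasCompactSupport hd
          h2.deriv).integrableOn
      · intro x hx
        rw [image_eq_zero_of_notMem_tsupport fun hx' => hx (h3 (tsupport_deriv_subset hx')),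
          zero_smul])
  obtain ⟨u, hu, hfu, hu0⟩ := h0
  have hae : ∀ᵐ t ∂(volume.restrict (Ioi (0 : ℝ))), u t - G t = c := by
    filter_upwards [hc, hfu, ae_restrict_mem measurableSet_Ioi] with t h1 h2 h3
    rw [← h1, Pi.sub_apply, indicator_of_mem h3, h2]
  have hall : EqOn (fun t => u t - G t) (fun _ => c) (Ioi 0) :=
    Measure.eqOn_open_of_ae_eq hae isOpen_Ioi
      ((hu.mono Ioi_subset_Ici_self).sub hGc.continuousOn) continuousOn_const
  have hc0 : c = 0 := by
    have hcont : Tendsto (fun t => u t - G t) (𝓝[>] 0) (𝓝 (u 0 - G 0)) :=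
      ((hu.sub hGc.continuousOn) 0 self_mem_Ici).mono_left (nhdsWithin_mono _ Ioi_subset_Ici_self)
    have hcont' : Tendsto (fun t => u t - G t) (𝓝[>] 0) (𝓝 c) :=
      tendsto_const_nhds.congr' (by
        filter_upwards [self_mem_nhdsWithin] with t ht using (hall ht).symm)
    rw [tendsto_nhds_unique hcont' hcont, hu0]
    simp [hG]
  filter_upwards [hae, hfu] with t h1 h2
  rw [h2]
  exact sub_eq_zero.1 (h1.trans hc0)

end DuBoisReymond

/-! ### Closed images, density by orthogonality, and `(1 + T*T)⁻¹`. -/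

section Abstract

/-- A map bounded below on a complete subspace is antilipschitz there, so its image is closed. -/
theorem isClosed_map_of_bound {F G : Type*} [NormedAddCommGroup F] [NormedSpace ℂ F]
    [CompleteSpace F] [NormedAddCommGroup G] [NormedSpace ℂ G] {M : Submodule ℂ F}
    (hM : IsClosed (M : Set F)) (L : F →L[ℂ] G) (C : NNReal) (h : ∀ x ∈ M, ‖x‖ ≤ C * ‖L x‖) :
    IsClosed (M.map (L : F →ₗ[ℂ] G) : Set G) := by
  have : CompleteSpace M := hM.completeSpace_coe
  have ha : AntilipschitzWith C (L.comp M.subtypeL) :=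
    ContinuousLinearMap.antilipschitz_of_bound _ fun x => h x x.2
  convert ha.isClosed_range (L.comp M.subtypeL).uniformContinuous using 1
  ext y
  simp

/-- A subspace `V` of a closed subspace `K` is dense in `K` if no nonzero vector of `K` is
orthogonal to `V`. -/
theorem le_topologicalClosure_of_orthogonal {F G : Type*} [NormedAddCommGroup F]
    [NormedSpace ℂ F] [NormedAddCommGroup G] [InnerProductSpace ℂ G] [CompleteSpace G]
    (e : F ≃L[ℂ] G) {V K : Submodule ℂ F} (hK : IsClosed (K : Set F)) (hVK : V ≤ K)
    (h : ∀ y ∈ K, (∀ v ∈ V, inner ℂ (e v) (e y) = 0) → y = 0) : K ≤ V.topologicalClosure := by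
  intro y hy
  let W : Submodule ℂ G := V.topologicalClosure.comap (e.symm : G →ₗ[ℂ] F)
  have hW : IsClosed (W : Set G) := V.isClosed_topologicalClosure.preimage e.symm.continuous
  have : CompleteSpace W := hW.completeSpace_coe
  have hWK : V.topologicalClosure ≤ K := V.topologicalClosure_minimal hVK hK
  have hP : e.symm (W.starProjection (e y)) ∈ V.topologicalClosure :=
    W.starProjection_apply_mem (e y)
  -- The residual of the projection onto the closure of `V` lies in `K` and is orthogonal to `V`,
  -- hence vanishes.
  have hz := h (y - e.symm (W.starProjection (e y))) (K.sub_mem hy (hWK hP)) fun v hv => by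
    have hvW : e v ∈ W := by
      change e.symm (e v) ∈ V.topologicalClosure
      rw [e.symm_apply_apply]
      exact V.le_topologicalClosure hv
    have := W.starProjection_inner_eq_zero (e y) (e v) hvW
    rw [map_sub, e.apply_symm_apply, ← inner_conj_symm, this, map_zero]
  rw [sub_eq_zero.1 hz]
  exact hP

/-- The product carries the maximum norm; `WithLp 2` supplies an equivalent Hilbert norm. -/
theorem le_topologicalClosure_of_pair_orthogonal {X : Type*} [NormedAddCommGroup X]
    [InnerProductSpace ℂ X] [CompleteSpace X] {V K : Submodule ℂ (X × X)} (hK : IsClosed (K : Set (X × X)))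
    (hVK : V ≤ K)
    (h : ∀ y ∈ K, (∀ v ∈ V, inner ℂ v.1 y.1 + inner ℂ v.2 y.2 = 0) → y = 0) :
    K ≤ V.topologicalClosure :=
  le_topologicalClosure_of_orthogonal (WithLp.prodContinuousLinearEquiv 2 ℂ X X).symm hK hVK
    fun y hy hv => h y hy fun v hvV => by simpa [WithLp.prod_inner_apply] using hv v hvV

theorem le_topologicalClosure_of_triple_orthogonal {X : Type*} [NormedAddCommGroup X]
    [InnerProductSpace ℂ X] [CompleteSpace X] {V K : Submodule ℂ (X × X × X)}
    (hK : IsClosed (K : Set (X × X × X))) (hVK : V ≤ K)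
    (h : ∀ y ∈ K, (∀ v ∈ V, inner ℂ v.1 y.1 + (inner ℂ v.2.1 y.2.1 + inner ℂ v.2.2 y.2.2) = 0) →
      y = 0) : K ≤ V.topologicalClosure :=
  le_topologicalClosure_of_orthogonal
    (((ContinuousLinearEquiv.refl ℂ X).prodCongr
      (WithLp.prodContinuousLinearEquiv 2 ℂ X X).symm).trans
      (WithLp.prodContinuousLinearEquiv 2 ℂ X (WithLp 2 (X × X))).symm) hK hVK
    fun y hy hv => h y hy fun v hvV => by simpa [WithLp.prod_inner_apply] using hv v hvV

/-- For a closed operator `T`, there are bounded operators `S = (1 + T* T)⁻¹` and `S' = T S`. -/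
theorem exists_inverse_one_add_adjoint_mul_self {H : Type*} [NormedAddCommGroup H]
    [InnerProductSpace ℂ H] [CompleteSpace H] {T : H →ₗ.[ℂ] H} (hT : T.IsClosed) :
    ∃ S S' : H →L[ℂ] H, (∀ k, (S k, S' k) ∈ T.graph) ∧
      ∀ k, ∀ p ∈ T.graph, inner ℂ k p.1 = inner ℂ (S k) p.1 + inner ℂ (S' k) p.2 := by
  let e := WithLp.prodContinuousLinearEquiv 2 ℂ H H
  let Γ : Submodule ℂ (WithLp 2 (H × H)) := T.graph.comap (e : WithLp 2 (H × H) →ₗ[ℂ] H × H)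
  have hΓ : IsClosed (Γ : Set (WithLp 2 (H × H))) := IsClosed.preimage e.continuous hT
  have : CompleteSpace Γ := hΓ.completeSpace_coe
  -- `Q k = (S k, T S k)` is the orthogonal projection of `(k, 0)` onto the graph of `T`;
  -- orthogonality of the residual is the claimed identity.
  let Q : H →L[ℂ] H × H := (e : WithLp 2 (H × H) →L[ℂ] H × H) ∘L Γ.starProjection ∘L
    (e.symm : H × H →L[ℂ] WithLp 2 (H × H)) ∘L ContinuousLinearMap.inl ℂ H H
  refine ⟨ContinuousLinearMap.fst ℂ H H ∘L Q, ContinuousLinearMap.snd ℂ H H ∘L Q,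
    fun k => Γ.starProjection_apply_mem (e.symm (k, 0)), fun k p hp => ?_⟩
  have h := Γ.starProjection_inner_eq_zero (e.symm (k, 0)) (e.symm p)
    (by change e (e.symm p) ∈ T.graph; rwa [e.apply_symm_apply])
  rw [inner_sub_left, sub_eq_zero] at h
  simpa [WithLp.prod_inner_apply, e, Q] using h

end Abstract

/-! ### The spaces of triples `(f, f'', Tf)`: closedness, density, coercivity. -/

section Triples

section SecondDerivZero

variable {E : Type*} [NormedAddCommGroup E] [NormedSpace ℂ E]

/-- The graph of `f ↦ f''` on `W^{2,2}_0(ℝ₊, E)`. -/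
def secondDerivZeroGraph (E : Type*) [NormedAddCommGroup E] [NormedSpace ℂ E] :
    Submodule ℂ (L2 E × L2 E) where
  carrier := {p | ∃ f₁ : L2 E, IsPrimitive p.1 f₁ ∧ IsPrimitive f₁ p.2}
  zero_mem' := ⟨0, IsPrimitive.zero, IsPrimitive.zero⟩
  add_mem' := by
    rintro p q ⟨f₁, h₁, h₂⟩ ⟨g₁, k₁, k₂⟩
    exact ⟨f₁ + g₁, h₁.add k₁, h₂.add k₂⟩
  smul_mem' := by
    rintro c p ⟨f₁, h₁, h₂⟩
    exact ⟨c • f₁, h₁.smul c, h₂.smul c⟩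

variable [CompleteSpace E]

theorem secondDerivZeroGraph_le : secondDerivZeroGraph E ≤ secondDerivGraph E := by
  rintro p ⟨f₁, h₁, h₂⟩
  exact ⟨f₁, h₁.hasWeakDeriv, h₂.hasWeakDeriv⟩

theorem mem_W22Zero_iff {f : L2 E} : f ∈ W22Zero E ↔ ∃ f₂, (f, f₂) ∈ secondDerivZeroGraph E := by
  constructor
  · rintro ⟨f₁, f₂, h₁, h₂, h₃, h₄⟩
    exact ⟨f₂, f₁, h₁.isPrimitive h₃, h₂.isPrimitive h₄⟩
  · rintro ⟨f₂, f₁, h₁, h₂⟩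
    exact ⟨f₁, f₂, h₁.hasWeakDeriv, h₂.hasWeakDeriv, h₁.hasBoundaryValue, h₂.hasBoundaryValue⟩

theorem eq_zero_of_mem_secondDerivZeroGraph {p : L2 E × L2 E} (hp : p ∈ secondDerivZeroGraph E)
    (h : p.1 = 0) : p = 0 := by
  obtain ⟨f₁, h₁, h₂⟩ := hp
  exact Prod.ext h (h₂.hasWeakDeriv.eq_zero (h₁.hasWeakDeriv.eq_zero h))

theorem compLp_mem_secondDerivZeroGraph {F : Type*} [NormedAddCommGroup F] [NormedSpace ℂ F]
    [CompleteSpace F] (L : E →L[ℂ] F) {p : L2 E × L2 E} (hp : p ∈ secondDerivZeroGraph E) :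
    (L.compLp p.1, L.compLp p.2) ∈ secondDerivZeroGraph F := by
  obtain ⟨f₁, h₁, h₂⟩ := hp
  exact ⟨L.compLp f₁, h₁.compLp L, h₂.compLp L⟩

theorem IsPrimitive.tensor {φ ψ : L2 ℂ} (hφ : IsPrimitive φ ψ) (h : E) :
    IsPrimitive (SturmLiouville.tensor φ h) (SturmLiouville.tensor ψ h) :=
  hφ.compLp _

end SecondDerivZero

variable {H : Type*} [NormedAddCommGroup H] [InnerProductSpace ℂ H] [CompleteSpace H]

/-- The triples `(f, f', f'')` form a closed space, and dropping `f'` is bounded below because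
`‖f'‖² ≤ ‖f‖ ‖f''‖`. -/
theorem isClosed_secondDerivZeroGraph : IsClosed (secondDerivZeroGraph H : Set (L2 H × L2 H)) := by
  let M : Submodule ℂ (L2 H × L2 H × L2 H) :=
    { carrier := {p | IsPrimitive p.1 p.2.1 ∧ IsPrimitive p.2.1 p.2.2}
      zero_mem' := ⟨IsPrimitive.zero, IsPrimitive.zero⟩
      add_mem' := fun h h' => ⟨h.1.add h'.1, h.2.add h'.2⟩
      smul_mem' := fun c _ h => ⟨h.1.smul c, h.2.smul c⟩ }
  have hM : IsClosed (M : Set (L2 H × L2 H × L2 H)) :=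
    (isClosed_isPrimitive.preimage (f := fun p : L2 H × L2 H × L2 H => (p.1, p.2.1))
      (by fun_prop)).inter
    (isClosed_isPrimitive.preimage (f := fun p : L2 H × L2 H × L2 H => (p.2.1, p.2.2))
      (by fun_prop))
  let L : L2 H × L2 H × L2 H →L[ℂ] L2 H × L2 H :=
    (ContinuousLinearMap.fst ℂ _ _).prod
      ((ContinuousLinearMap.snd ℂ _ _).comp (ContinuousLinearMap.snd ℂ _ _))
  have hb : ∀ x ∈ M, ‖x‖ ≤ (1 : NNReal) * ‖L x‖ := by
    rintro ⟨f, f₁, f₂⟩ ⟨h₁, h₂⟩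
    have h := h₁.norm_sq_le h₂
    have hf₁ : ‖f₁‖ ≤ max ‖f‖ ‖f₂‖ := by
      refine le_of_sq_le_sq (h.trans ?_) (le_max_of_le_left (norm_nonneg _))
      rw [sq]
      exact mul_le_mul (le_max_left _ _) (le_max_right _ _) (norm_nonneg _)
        (le_max_of_le_left (norm_nonneg _))
    have hL : ‖L (f, f₁, f₂)‖ = max ‖f‖ ‖f₂‖ := rfl
    rw [NNReal.coe_one, one_mul, hL]
    exact max_le (le_max_left _ _) (max_le hf₁ (le_max_right _ _))
  have hmap : secondDerivZeroGraph H = M.map (L : L2 H × L2 H × L2 H →ₗ[ℂ] L2 H × L2 H) := by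
    refine Submodule.ext fun p => ?_
    obtain ⟨f, f₂⟩ := p
    constructor
    · rintro ⟨f₁, h₁, h₂⟩
      exact ⟨(f, f₁, f₂), ⟨h₁, h₂⟩, rfl⟩
    · rintro ⟨⟨g, g₁, g₂⟩, ⟨h₁, h₂⟩, hL⟩
      obtain ⟨rfl, rfl⟩ := Prod.mk.inj hL
      exact ⟨g₁, h₁, h₂⟩
  rw [hmap]
  exact isClosed_map_of_bound hM L 1 hb

omit [CompleteSpace H] in
-- Both components converge almost everywhere along a common subsequence, and the graph of `T` is
-- closed.
theorem isClosed_pointwiseGraph {T : H →ₗ.[ℂ] H} (hT : T.IsClosed) :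
    IsClosed (pointwiseGraph T : Set (L2 H × L2 H)) := by
  refine IsSeqClosed.isClosed fun u p hu hp => ?_
  have h1 : Tendsto (fun n => (u n).1) atTop (𝓝 p.1) := (continuous_fst.tendsto p).comp hp
  have h2 : Tendsto (fun n => (u n).2) atTop (𝓝 p.2) := (continuous_snd.tendsto p).comp hp
  obtain ⟨ns, hns, hae⟩ := (tendstoInMeasure_of_tendsto_Lp h1).exists_seq_tendsto_ae
  obtain ⟨ms, hms, hae'⟩ := (tendstoInMeasure_of_tendsto_Lp
    (h2.comp hns.tendsto_atTop)).exists_seq_tendsto_ae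
  have hu' : ∀ᵐ t ∂(volume.restrict (Ioi (0 : ℝ))), ∀ n, ((u n).1 t, (u n).2 t) ∈ T.graph :=
    ae_all_iff.2 hu
  change ∀ᵐ t ∂(volume.restrict (Ioi (0 : ℝ))), (p.1 t, p.2 t) ∈ T.graph
  filter_upwards [hae, hae', hu'] with t h3 h4 h5
  exact hT.mem_of_tendsto ((h3.comp hms.tendsto_atTop).prodMk_nhds h4)
    (Eventually.of_forall fun n => h5 _)

omit [CompleteSpace H] in
theorem re_inner_nonneg_of_ae {f g : L2 H}
    (h : ∀ᵐ t ∂(volume.restrict (Ioi (0 : ℝ))), 0 ≤ (inner ℂ (f t) (g t)).re) :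
    0 ≤ (inner ℂ f g).re := by
  rw [L2.inner_def]
  have := integral_re (𝕜 := ℂ) (L2.integrable_inner (𝕜 := ℂ) f g)
  exact (integral_nonneg_of_ae h).trans_eq this

omit [CompleteSpace H] in
theorem inner_tensor_left (φ : L2 ℂ) (k : H) (g : L2 H) :
    inner ℂ (tensor φ k) g = inner ℂ φ ((innerSL ℂ k).compLp g) := by
  rw [L2.inner_def, L2.inner_def]
  refine integral_congr_ae ?_
  filter_upwards [coeFn_tensor φ k, (innerSL ℂ k).coeFn_compLp g] with t h1 h2
  rw [h1, h2, inner_smul_left]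
  simp [mul_comm]

/-- The elementary pairs `(φ k, φ'' k)`, with `φ ∈ W^{2,2}_0(ℝ₊)` and `k ∈ H`, span a dense
subspace of the graph of the second derivative on `W^{2,2}_0(ℝ₊, H)`. -/
theorem secondDerivZeroGraph_le_closure_tensor [TopologicalSpace.SeparableSpace H] :
    secondDerivZeroGraph H ≤ (Submodule.span ℂ {p : L2 H × L2 H |
      ∃ φ ∈ secondDerivZeroGraph ℂ, ∃ k : H,
        p = (tensor φ.1 k, tensor φ.2 k)}).topologicalClosure := by
  refine le_topologicalClosure_of_pair_orthogonal isClosed_secondDerivZeroGraph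
    (Submodule.span_le.2 ?_) fun y hy hv => eq_zero_of_mem_secondDerivZeroGraph hy ?_
  · rintro _ ⟨φ, hφ, k, rfl⟩
    exact compLp_mem_secondDerivZeroGraph _ hφ
  -- The scalar function `⟨k, y⟩` lies in `W^{2,2}_0(ℝ₊)` and serves as its own test function `φ`.
  have hk : ∀ k : H, (innerSL ℂ k).compLp y.1 = 0 := fun k => by
    have h := hv _ (Submodule.subset_span
      ⟨_, compLp_mem_secondDerivZeroGraph (innerSL ℂ k) hy, k, rfl⟩)
    simp only [inner_tensor_left, inner_self_eq_norm_sq_to_K] at h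
    have h' : ‖(innerSL ℂ k).compLp y.1‖ ^ 2 + ‖(innerSL ℂ k).compLp y.2‖ ^ 2 = 0 := by
      exact Complex.ofReal_injective (by push_cast; exact h)
    have h1 : ‖(innerSL ℂ k).compLp y.1‖ ^ 2 = 0 := by
      nlinarith [sq_nonneg ‖(innerSL ℂ k).compLp y.1‖, sq_nonneg ‖(innerSL ℂ k).compLp y.2‖]
    exact norm_eq_zero.1 (pow_eq_zero_iff two_ne_zero |>.1 h1)
  -- A countable dense set of `k` gives one null set valid for all of them; this is where
  -- separability enters.
  have hae : ∀ᵐ t ∂(volume.restrict (Ioi (0 : ℝ))), ∀ n,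
      inner ℂ (TopologicalSpace.denseSeq H n) (y.1 t) = 0 := ae_all_iff.2 fun n => by
    filter_upwards [(innerSL ℂ (TopologicalSpace.denseSeq H n)).coeFn_compLp y.1,
      (Lp.eq_zero_iff_ae_eq_zero).1 (hk (TopologicalSpace.denseSeq H n))] with t h1 h2
    rw [h2] at h1
    exact h1.symm
  rw [Lp.eq_zero_iff_ae_eq_zero]
  filter_upwards [hae] with t ht
  have hcl : IsClosed {k : H | inner ℂ k (y.1 t) = 0} :=
    isClosed_eq (by fun_prop) continuous_const
  have hmem := closure_minimal (range_subset_iff.2 ht) hcl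
    (TopologicalSpace.denseRange_denseSeq H (y.1 t))
  exact inner_self_eq_zero.1 hmem

/-- The triples `(f, f'', T f)` with `f ∈ W^{2,2}_{0,T}(ℝ₊, H)`. -/
def tripleGraph (T : H →ₗ.[ℂ] H) : Submodule ℂ (L2 H × L2 H × L2 H) :=
  (secondDerivZeroGraph H).comap ((LinearMap.fst ℂ _ _).prod
      ((LinearMap.fst ℂ _ _).comp (LinearMap.snd ℂ _ _))) ⊓
    (pointwiseGraph T).comap ((LinearMap.fst ℂ _ _).prod
      ((LinearMap.snd ℂ _ _).comp (LinearMap.snd ℂ _ _)))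

omit [CompleteSpace H] in
theorem mem_tripleGraph {T : H →ₗ.[ℂ] H} {f f₂ q : L2 H} : (f, f₂, q) ∈ tripleGraph T ↔
    (f, f₂) ∈ secondDerivZeroGraph H ∧ (f, q) ∈ pointwiseGraph T :=
  Iff.rfl

/-- The triples `(f, f'', T f)` with `f ∈ 𝒟₀`. -/
def tensorTriples (T : H →ₗ.[ℂ] H) : Submodule ℂ (L2 H × L2 H × L2 H) :=
  Submodule.span ℂ {p | ∃ φ ∈ secondDerivZeroGraph ℂ, ∃ h ∈ T.graph,
    p = (tensor φ.1 h.1, tensor φ.2 h.1, tensor φ.1 h.2)}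

theorem isClosed_tripleGraph {T : H →ₗ.[ℂ] H} (hT : T.IsClosed) :
    IsClosed (tripleGraph T : Set (L2 H × L2 H × L2 H)) :=
  (isClosed_secondDerivZeroGraph.preimage (f := fun p : L2 H × L2 H × L2 H => (p.1, p.2.1))
    (by fun_prop)).inter
  ((isClosed_pointwiseGraph hT).preimage (f := fun p : L2 H × L2 H × L2 H => (p.1, p.2.2))
    (by fun_prop))

omit [CompleteSpace H] in
theorem tensor_mem_pointwiseGraph {T : H →ₗ.[ℂ] H} (φ : L2 ℂ) {h : H × H} (hh : h ∈ T.graph) :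
    (tensor φ h.1, tensor φ h.2) ∈ pointwiseGraph T := by
  change ∀ᵐ t ∂(volume.restrict (Ioi (0 : ℝ))), (tensor φ h.1 t, tensor φ h.2 t) ∈ T.graph
  filter_upwards [coeFn_tensor φ h.1, coeFn_tensor φ h.2] with t e1 e2
  rw [e1, e2]
  exact T.graph.smul_mem (φ t) hh

theorem tensorTriples_le (T : H →ₗ.[ℂ] H) : tensorTriples T ≤ tripleGraph T := by
  refine Submodule.span_le.2 ?_
  rintro _ ⟨φ, hφ, h, hh, rfl⟩
  exact ⟨compLp_mem_secondDerivZeroGraph _ hφ, tensor_mem_pointwiseGraph φ.1 hh⟩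

/-- `𝒟₀` is dense in `W^{2,2}_{0,T}(ℝ₊, H)`. -/
theorem tripleGraph_le_closure [TopologicalSpace.SeparableSpace H] {T : H →ₗ.[ℂ] H}
    (hT : T.IsClosed) : tripleGraph T ≤ (tensorTriples T).topologicalClosure := by
  refine le_topologicalClosure_of_triple_orthogonal (isClosed_tripleGraph hT)
    (tensorTriples_le T) ?_
  rintro ⟨g, g₂, q⟩ ⟨hg, hq⟩ hv
  obtain ⟨S, S', hS, hS'⟩ := exists_inverse_one_add_adjoint_mul_self hT
  set w : L2 H := (ContinuousLinearMap.adjoint S).compLp g₂ with hw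
  let Λ : L2 H × L2 H →L[ℂ] ℂ := (innerSL ℂ g).comp (ContinuousLinearMap.fst ℂ _ _) +
    (innerSL ℂ w).comp (ContinuousLinearMap.snd ℂ _ _)
  have hΛ : ∀ p, Λ p = inner ℂ g p.1 + inner ℂ w p.2 := fun p => rfl
  -- Testing with `h = S k` turns `⟨S k, g⟩ + ⟨T S k, T g⟩` into `⟨k, g⟩`, so `T` disappears and
  -- density of the elementary pairs applies.
  have hker : secondDerivZeroGraph H ≤ LinearMap.ker (Λ : L2 H × L2 H →ₗ[ℂ] ℂ) := by
    refine secondDerivZeroGraph_le_closure_tensor.trans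
      (Submodule.topologicalClosure_minimal _ (Submodule.span_le.2 ?_) Λ.isClosed_ker)
    rintro _ ⟨φ, hφ, k, rfl⟩
    have h := hv _ (Submodule.subset_span ⟨φ, hφ, _, hS k, rfl⟩)
    simp only [inner_tensor_left] at h
    have e1 : (innerSL ℂ (S k)).compLp g₂ = (innerSL ℂ k).compLp w := by
      refine Lp.ext ?_
      filter_upwards [(innerSL ℂ (S k)).coeFn_compLp g₂, (innerSL ℂ k).coeFn_compLp w,
        (ContinuousLinearMap.adjoint S).coeFn_compLp g₂] with t h1 h2 h3
      rw [h1, h2, hw, h3, innerSL_apply_apply, innerSL_apply_apply,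
        ContinuousLinearMap.adjoint_inner_right]
    have e2 : (innerSL ℂ (S k)).compLp g + (innerSL ℂ (S' k)).compLp q =
        (innerSL ℂ k).compLp g := by
      refine Lp.ext ?_
      filter_upwards [(innerSL ℂ (S k)).coeFn_compLp g, (innerSL ℂ k).coeFn_compLp g,
        (innerSL ℂ (S' k)).coeFn_compLp q, hq,
        Lp.coeFn_add ((innerSL ℂ (S k)).compLp g) ((innerSL ℂ (S' k)).compLp q)]
        with t h1 h2 h3 h4 h5
      rw [h5, Pi.add_apply, h1, h2, h3]
      exact (hS' k _ h4).symm
    have h' : inner ℂ (tensor φ.1 k) g + inner ℂ (tensor φ.2 k) w = 0 := by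
      rw [inner_tensor_left, inner_tensor_left, ← e1, ← e2, inner_add_right, ← h]
      ring
    change Λ _ = 0
    rw [hΛ, ← inner_conj_symm, ← inner_conj_symm w, ← map_add, h', map_zero]
  have h0 : inner ℂ g g + inner ℂ w g₂ = 0 := hker hg
  -- Pointwise, `⟨S* g₂, g₂⟩ = ⟨g₂, S g₂⟩ = ‖S g₂‖² + ‖T S g₂‖²`.
  have hpos : 0 ≤ (inner ℂ w g₂).re := by
    refine re_inner_nonneg_of_ae ?_
    filter_upwards [(ContinuousLinearMap.adjoint S).coeFn_compLp g₂] with t ht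
    rw [hw, ht, ContinuousLinearMap.adjoint_inner_left, hS' _ _ (hS (g₂ t))]
    exact add_nonneg (inner_self_nonneg (𝕜 := ℂ)) (inner_self_nonneg (𝕜 := ℂ))
  have hg0 : g = 0 := by
    have h1 := congrArg Complex.re h0
    have h2 : (inner ℂ g g).re = ‖g‖ ^ 2 := inner_self_eq_norm_sq (𝕜 := ℂ) g
    rw [Complex.add_re, h2, Complex.zero_re] at h1
    have h3 : ‖g‖ ^ 2 = 0 := by nlinarith [sq_nonneg ‖g‖]
    exact norm_eq_zero.1 (pow_eq_zero_iff two_ne_zero |>.1 h3)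
  have hg₂ : g₂ = 0 := congrArg Prod.snd (eq_zero_of_mem_secondDerivZeroGraph hg hg0)
  have hq0 : q = 0 := by
    rw [← pointwise_graph] at hq
    exact (pointwise T).graph_fst_eq_zero_snd hq hg0
  rw [hg0, hg₂, hq0]
  rfl

/-- The cross term is `-2 Re ⟨Tf, f''⟩ = 2 Re ⟨Tf', f'⟩ ≥ 0`. For finite sums `f'` takes values in
`dom T` and `Tf` is the primitive of `Tf'`, which justifies the integration by parts. -/
theorem norm_sq_add_le_of_mem_tensorTriples {T : H →ₗ.[ℂ] H}
    (hT : ∀ x : T.domain, 0 ≤ (inner ℂ (T x) (x : H)).re) {p : L2 H × L2 H × L2 H}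
    (hp : p ∈ tensorTriples T) : ‖p.2.1‖ ^ 2 + ‖p.2.2‖ ^ 2 ≤ ‖p.2.2 - p.2.1‖ ^ 2 := by
  obtain ⟨f₁, q₁, -, h₂, h₃, h₄⟩ : ∃ f₁ q₁ : L2 H, IsPrimitive p.1 f₁ ∧ IsPrimitive f₁ p.2.1 ∧
      IsPrimitive p.2.2 q₁ ∧ (f₁, q₁) ∈ pointwiseGraph T := by
    refine Submodule.span_induction ?_ ?_ ?_ ?_ hp
    · rintro _ ⟨φ, ⟨φ₁, k₁, k₂⟩, h, hh, rfl⟩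
      exact ⟨tensor φ₁ h.1, tensor φ₁ h.2, k₁.tensor h.1, k₂.tensor h.1, k₁.tensor h.2,
        tensor_mem_pointwiseGraph φ₁ hh⟩
    · exact ⟨0, 0, .zero, .zero, .zero, (pointwiseGraph T).zero_mem⟩
    · rintro x y - - ⟨f, q, a1, a2, a3, a4⟩ ⟨f', q', b1, b2, b3, b4⟩
      have h := (pointwiseGraph T).add_mem a4 b4
      rw [Prod.mk_add_mk] at h
      exact ⟨f + f', q + q', a1.add b1, a2.add b2, a3.add b3, h⟩
    · rintro c x - ⟨f, q, a1, a2, a3, a4⟩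
      have h := (pointwiseGraph T).smul_mem c a4
      rw [Prod.smul_mk] at h
      exact ⟨c • f, c • q, a1.smul c, a2.smul c, a3.smul c, h⟩
  have hpos : 0 ≤ (inner ℂ q₁ f₁).re := by
    refine re_inner_nonneg_of_ae ?_
    have h₄' : ∀ᵐ t ∂(volume.restrict (Ioi (0 : ℝ))), (f₁ t, q₁ t) ∈ T.graph := h₄
    filter_upwards [h₄'] with t ht
    obtain ⟨x, hx1, hx2⟩ := (T.mem_graph_iff).1 ht
    have := hT x
    rwa [hx1, hx2] at this
  have hibp : (inner ℂ p.2.2 p.2.1).re = -(inner ℂ q₁ f₁).re := by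
    have := congrArg Complex.re (h₃.inner_eq_neg h₂)
    rw [Complex.neg_re] at this
    linarith
  have := norm_sub_sq (𝕜 := ℂ) p.2.2 p.2.1
  rw [this]
  change _ ≤ _ - 2 * (inner ℂ p.2.2 p.2.1).re + _
  linarith

/-- The coercivity estimate `‖f''‖² + ‖T f‖² ≤ ‖-f'' + T f‖²` on `W^{2,2}_{0,T}(ℝ₊, H)`. -/
theorem norm_sq_add_le_of_mem_tripleGraph [TopologicalSpace.SeparableSpace H] {T : H →ₗ.[ℂ] H}
    (hT : T.IsClosed) (hpos : ∀ x : T.domain, 0 ≤ (inner ℂ (T x) (x : H)).re)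
    {p : L2 H × L2 H × L2 H} (hp : p ∈ tripleGraph T) :
    ‖p.2.1‖ ^ 2 + ‖p.2.2‖ ^ 2 ≤ ‖p.2.2 - p.2.1‖ ^ 2 := by
  have hcl : IsClosed {p : L2 H × L2 H × L2 H |
      ‖p.2.1‖ ^ 2 + ‖p.2.2‖ ^ 2 ≤ ‖p.2.2 - p.2.1‖ ^ 2} :=
    isClosed_le (by fun_prop) (by fun_prop)
  refine closure_minimal (fun x hx => ?_) hcl (tripleGraph_le_closure hT hp)
  have := norm_sq_add_le_of_mem_tensorTriples hpos hx
  exact this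

end Triples

/-! ### From triples to operator graphs. -/

section Graph

variable {H : Type*} [NormedAddCommGroup H] [InnerProductSpace ℂ H] [CompleteSpace H]

theorem mem_graph_domRestrict {F : Type*} [NormedAddCommGroup F] [NormedSpace ℂ F]
    {A : F →ₗ.[ℂ] F} {S : Submodule ℂ F} {f g : F} :
    (f, g) ∈ (A.domRestrict S).graph ↔ f ∈ S ∧ (f, g) ∈ A.graph := by
  simp only [LinearPMap.mem_graph_iff]
  constructor
  · rintro ⟨x, rfl, rfl⟩
    exact ⟨x.2.1, ⟨x, x.2.2⟩, rfl, (LinearPMap.domRestrict_apply rfl).symm⟩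
  · rintro ⟨hf, x, rfl, rfl⟩
    exact ⟨⟨x, hf, x.2⟩, rfl, LinearPMap.domRestrict_apply rfl⟩

theorem mem_graph_expression {T : H →ₗ.[ℂ] H} {f f₂ q : L2 H} (h₁ : (f, f₂) ∈ secondDerivGraph H)
    (h₂ : (f, q) ∈ pointwiseGraph T) : (f, q - f₂) ∈ (expression T).graph := by
  rw [← secondDeriv_graph, LinearPMap.mem_graph_iff] at h₁
  rw [← pointwise_graph, LinearPMap.mem_graph_iff] at h₂
  obtain ⟨x, rfl, rfl⟩ := h₁
  obtain ⟨y, hy, rfl⟩ := h₂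
  rw [LinearPMap.mem_graph_iff]
  obtain ⟨y, hy'⟩ := y
  obtain rfl : y = x := hy
  refine ⟨⟨x, x.2, hy'⟩, rfl, ?_⟩
  refine (LinearPMap.add_apply _ _ _).trans ?_
  rw [LinearPMap.neg_apply, neg_add_eq_sub]
  rfl

/-- The map `(f, f'', T f) ↦ (f, -f'' + T f)`. -/
def tripleToGraph (H : Type*) [NormedAddCommGroup H] [InnerProductSpace ℂ H] :
    L2 H × L2 H × L2 H →L[ℂ] L2 H × L2 H :=
  (ContinuousLinearMap.fst ℂ _ _).prod
    ((ContinuousLinearMap.snd ℂ (L2 H) (L2 H) - ContinuousLinearMap.fst ℂ (L2 H) (L2 H)).comp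
      (ContinuousLinearMap.snd ℂ _ _))

theorem tripleToGraph_mem_graph_expression {T : H →ₗ.[ℂ] H} {p : L2 H × L2 H × L2 H}
    (hp : p ∈ tripleGraph T) : tripleToGraph H p ∈ (expression T).graph :=
  mem_graph_expression (secondDerivZeroGraph_le hp.1) hp.2

/-- The graph of the restriction of `𝒜` to a subspace `S`, in terms of a space of triples
`(f, f'', T f)` that projects onto `S`. -/
theorem graph_domRestrict_expression {T : H →ₗ.[ℂ] H} {S : Submodule ℂ (L2 H)}
    {M : Submodule ℂ (L2 H × L2 H × L2 H)} (hM : M ≤ tripleGraph T)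
    (hS : ∀ f, f ∈ S ↔ ∃ p ∈ M, p.1 = f) :
    ((expression T).domRestrict S).graph =
      M.map (tripleToGraph H : L2 H × L2 H × L2 H →ₗ[ℂ] L2 H × L2 H) := by
  refine Submodule.ext fun x => ?_
  obtain ⟨f, g⟩ := x
  rw [mem_graph_domRestrict]
  constructor
  · rintro ⟨hf, hg⟩
    obtain ⟨p, hp, rfl⟩ := (hS f).1 hf
    refine ⟨p, hp, Prod.ext rfl ?_⟩
    exact (expression T).mem_graph_snd_inj (tripleToGraph_mem_graph_expression (hM hp)) hg rfl
  · rintro ⟨p, hp, hpx⟩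
    obtain rfl : p.1 = f := congrArg Prod.fst hpx
    refine ⟨(hS _).2 ⟨p, hp, rfl⟩, ?_⟩
    rw [← hpx]
    exact tripleToGraph_mem_graph_expression (hM hp)

omit [CompleteSpace H] in
theorem mem_D₀_iff {T : H →ₗ.[ℂ] H} (f : L2 H) : f ∈ D₀ T ↔ ∃ p ∈ tensorTriples T, p.1 = f := by
  have h : D₀ T = (tensorTriples T).map (LinearMap.fst ℂ _ _) := by
    rw [tensorTriples, Submodule.map_span, D₀]
    congr 1
    refine Set.ext fun x => ⟨?_, ?_⟩
    · rintro ⟨φ, hφ, h, hh, rfl⟩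
      obtain ⟨φ₂, hφ₂⟩ := mem_W22Zero_iff.1 hφ
      exact ⟨_, ⟨(φ, φ₂), hφ₂, (h, T ⟨h, hh⟩), T.mem_graph ⟨h, hh⟩, rfl⟩, rfl⟩
    · rintro ⟨_, ⟨φ, hφ, h, hh, rfl⟩, rfl⟩
      obtain ⟨y, hy, -⟩ := T.mem_graph_iff.1 hh
      exact ⟨φ.1, mem_W22Zero_iff.2 ⟨φ.2, hφ⟩, h.1, hy ▸ y.2, rfl⟩
  rw [h]
  exact Iff.rfl

theorem mem_W22ZeroT_iff {T : H →ₗ.[ℂ] H} (f : L2 H) :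
    f ∈ W22ZeroT T ↔ ∃ p ∈ tripleGraph T, p.1 = f := by
  constructor
  · rintro ⟨⟨-, h₂⟩, h₃⟩
    obtain ⟨f₂, hf₂⟩ := mem_W22Zero_iff.1 h₃
    have hq := (pointwise T).mem_graph ⟨f, h₂⟩
    rw [pointwise_graph] at hq
    exact ⟨(f, f₂, _), ⟨hf₂, hq⟩, rfl⟩
  · rintro ⟨⟨f, f₂, q⟩, ⟨h₁, h₂⟩, rfl⟩
    exact ⟨⟨⟨(f, f₂), secondDerivZeroGraph_le h₁, rfl⟩, ⟨(f, q), h₂, rfl⟩⟩,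
      mem_W22Zero_iff.2 ⟨f₂, h₁⟩⟩

theorem isClosed_map_tripleGraph [TopologicalSpace.SeparableSpace H] {T : H →ₗ.[ℂ] H}
    (hT : T.IsClosed) (hpos : ∀ x : T.domain, 0 ≤ (inner ℂ (T x) (x : H)).re) :
    IsClosed ((tripleGraph T).map (tripleToGraph H : L2 H × L2 H × L2 H →ₗ[ℂ] L2 H × L2 H) :
      Set (L2 H × L2 H)) := by
  have hM := isClosed_tripleGraph hT
  have hb : ∀ x ∈ tripleGraph T, ‖x‖ ≤ (1 : NNReal) * ‖tripleToGraph H x‖ := by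
    rintro ⟨f, f₂, q⟩ hp
    have h : ‖f₂‖ ^ 2 + ‖q‖ ^ 2 ≤ ‖q - f₂‖ ^ 2 := by
      have h := norm_sq_add_le_of_mem_tripleGraph hT hpos hp
      dsimp only at h
      exact h
    have h₂ : ‖f₂‖ ≤ ‖q - f₂‖ :=
      le_of_sq_le_sq (by linarith [sq_nonneg ‖q‖]) (norm_nonneg _)
    have hq : ‖q‖ ≤ ‖q - f₂‖ :=
      le_of_sq_le_sq (by linarith [sq_nonneg ‖f₂‖]) (norm_nonneg _)
    have hL : ‖tripleToGraph H (f, f₂, q)‖ = max ‖f‖ ‖q - f₂‖ := rfl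
    rw [NNReal.coe_one, one_mul, hL]
    exact max_le (le_max_left _ _)
      (max_le (h₂.trans (le_max_right _ _)) (hq.trans (le_max_right _ _)))
  exact isClosed_map_of_bound hM (tripleToGraph H) 1 hb

/-- One inclusion holds because the image of all triples is closed; the other because a continuous
map sends a closure into the closure of the image. -/
theorem topologicalClosure_graph_preminimal [TopologicalSpace.SeparableSpace H] {T : H →ₗ.[ℂ] H}
    (hT : T.IsClosed) (hpos : ∀ x : T.domain, 0 ≤ (inner ℂ (T x) (x : H)).re) :
    (preminimal T).graph.topologicalClosure =
      ((expression T).domRestrict (W22ZeroT T)).graph := by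
  rw [preminimal, graph_domRestrict_expression (tensorTriples_le T) mem_D₀_iff,
    graph_domRestrict_expression le_rfl mem_W22ZeroT_iff]
  refine le_antisymm (Submodule.topologicalClosure_minimal _
    (Submodule.map_mono (tensorTriples_le T)) ?_) ?_
  · exact isClosed_map_tripleGraph hT hpos
  · rintro _ ⟨p, hp, rfl⟩
    exact image_closure_subset_closure_image (tripleToGraph H).continuous
      ⟨p, tripleGraph_le_closure hT hp, rfl⟩

end Graph

end SturmLiouville

end

theorem lemma5p1 {H : Type*} [NormedAddCommGroup H] [InnerProductSpace ℂ H] [CompleteSpace H]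
    [TopologicalSpace.SeparableSpace H] (T : H →ₗ.[ℂ] H) (hT : IsSelfAdjoint T)
    (hT_nonneg : ∀ x : T.domain, 0 ≤ (inner ℂ (T x) (x : H)).re) :
    (SturmLiouville.preminimal T).IsClosable ∧
    (SturmLiouville.minimal T).domain = SturmLiouville.W22ZeroT T ∧
    ∃ c C : ℝ, 0 < c ∧ 0 < C ∧
      ∀ (f : SturmLiouville.L2 H) (hA : f ∈ (SturmLiouville.minimal T).domain)
        (hW : f ∈ SturmLiouville.W22ZeroT T),
        c * SturmLiouville.W22.norm T ⟨f, hW.1⟩ ≤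
            SturmLiouville.graphNorm (SturmLiouville.minimal T) ⟨f, hA⟩ ∧
          SturmLiouville.graphNorm (SturmLiouville.minimal T) ⟨f, hA⟩ ≤
            C * SturmLiouville.W22.norm T ⟨f, hW.1⟩ := by
  have hcl := SturmLiouville.topologicalClosure_graph_preminimal hT.isClosed hT_nonneg
  -- The closure of the graph of `A'` is itself the graph of an operator.
  have hclosable : (SturmLiouville.preminimal T).IsClosable := ⟨_, hcl⟩
  have hmin : SturmLiouville.minimal T =
      (SturmLiouville.expression T).domRestrict (SturmLiouville.W22ZeroT T) :=
    LinearPMap.eq_of_eq_graph (hclosable.graph_closure_eq_closure_graph.symm.trans hcl)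
  -- The constant `1` comes from coercivity, `√2` from `‖q - f₂‖² ≤ 2 (‖q‖² + ‖f₂‖²)`.
  refine ⟨hclosable, ?_, 1, √2, one_pos, by positivity, fun f hA hW => ?_⟩
  · rw [hmin, LinearPMap.domRestrict_domain]
    exact inf_eq_left.2 inf_le_left
  set f₂ := SturmLiouville.secondDeriv H ⟨f, hW.1.1⟩ with hf₂
  set q := SturmLiouville.pointwise T ⟨f, hW.1.2⟩ with hq
  have h₂ : (f, f₂) ∈ (SturmLiouville.secondDeriv H).graph :=
    (SturmLiouville.secondDeriv H).mem_graph ⟨f, hW.1.1⟩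
  have hq' : (f, q) ∈ SturmLiouville.pointwiseGraph T := by
    rw [← SturmLiouville.pointwise_graph]
    exact (SturmLiouville.pointwise T).mem_graph ⟨f, hW.1.2⟩
  have h₂' : (f, f₂) ∈ SturmLiouville.secondDerivZeroGraph H := by
    obtain ⟨g₂, hg₂⟩ := SturmLiouville.mem_W22Zero_iff.1 hW.2
    have hg₂' := SturmLiouville.secondDerivZeroGraph_le hg₂
    rw [← SturmLiouville.secondDeriv_graph] at hg₂'
    rwa [(SturmLiouville.secondDeriv H).mem_graph_snd_inj h₂ hg₂' rfl]
  have hval : SturmLiouville.minimal T ⟨f, hA⟩ = q - f₂ := by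
    have h := (SturmLiouville.minimal T).mem_graph ⟨f, hA⟩
    have h' : (f, q - f₂) ∈ (SturmLiouville.minimal T).graph := by
      rw [hmin, SturmLiouville.mem_graph_domRestrict]
      exact ⟨hW, SturmLiouville.mem_graph_expression
        (SturmLiouville.secondDerivZeroGraph_le h₂') hq'⟩
    exact (SturmLiouville.minimal T).mem_graph_snd_inj h h' rfl
  have hle := SturmLiouville.norm_sq_add_le_of_mem_tripleGraph hT.isClosed hT_nonneg
    (SturmLiouville.mem_tripleGraph.2 ⟨h₂', hq'⟩)
  dsimp only at hle
  rw [SturmLiouville.W22.norm, SturmLiouville.graphNorm, hval, one_mul,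
    ← Real.sqrt_mul zero_le_two]
  change √(‖f₂‖ ^ 2 + ‖f‖ ^ 2 + ‖q‖ ^ 2) ≤ √(‖f‖ ^ 2 + ‖q - f₂‖ ^ 2) ∧
    √(‖f‖ ^ 2 + ‖q - f₂‖ ^ 2) ≤ √(2 * (‖f₂‖ ^ 2 + ‖f‖ ^ 2 + ‖q‖ ^ 2))
  refine ⟨Real.sqrt_le_sqrt (by linarith), Real.sqrt_le_sqrt ?_⟩
  have htri : ‖q - f₂‖ ^ 2 ≤ (‖q‖ + ‖f₂‖) ^ 2 := by
    gcongr
    exact norm_sub_le q f₂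
  nlinarith [sq_nonneg (‖q‖ - ‖f₂‖), sq_nonneg ‖f‖]
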